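/- For a finite abelian group $G$ (written additively) and an integer $r\ge 1$, let $D_r(G)$ denote the $r$-wise Davenport constant of $G$: the least positive integer $k$ such that every finite sequence of elements of $G$ (repetitions allowed, order irrelevant) of length at least $k$ has $r$ pairwise disjoint nonempty zero-sum subsequences, that is, $r$ nonempty zero-sum sequences whose concatenation is a subsequence of the given one. Let $C_k$ denote the cyclic group of order $k$. Let $p$ be an odd prime, let $d\ge 2$, $m,n,r\ge 1$ be integers, and let $0\le e_1\le e_2\le\dots\le e_d$ be integers such that $$p^{e_d}\ \ge\ 1+\sum_{i=1}^{d-1}\left(p^{e_i}-1\right).$$ Let $$G=C_{p^{e_1}}\times\dots\times C_{p^{e_{d-2}}}\times C_{mp^{e_{d-1}}}\times C_{np^{e_d}}.$$ 1. If $m\mid n$, then $$rnp^{e_d}+(m-1)p^{e_{d-1}}+\sum_{i=1}^{d-1}p^{e_i}-d+1\ \le\ D_r(G)\ \le\ rnp^{e_d}+(m-1)p^{e_d}+\sum_{i=1}^{d-1}p^{e_i}-d+1.$$ 2. If $n\mid m$, then $$\max\left\{rnp^{e_d}+(m-1)p^{e_{d-1}}+\sum_{i=1}^{d-1}p^{e_i}-d+1,\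 \ np^{e_d}+(rm-1)p^{e_{d-1}}+\sum_{i=1}^{d-1}p^{e_i}-d+1\right\}\ \le\ D_r(G)$$ and $$D_r(G)\ \le\ rmp^{e_d}+(n-1)p^{e_d}+\sum_{i=1}^{d-1}p^{e_i}-d+1.$$ -/

import Mathlib

/-- A finite sequence over `G` (unordered, repetitions allowed) is a multiset. The sequence `S` has
`r` disjoint zero-sum subsequences if there are nonempty sequences `T 0, …, T (r - 1)`, each of
sum `0`, whose concatenation is a subsequence of `S` (multiplicities are counted). -/
def HasDisjointZeroSums {G : Type*} [AddCommGroup G] (r : ℕ) (S : Multiset G) : Prop :=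
  ∃ T : Fin r → Multiset G, (∀ i, T i ≠ 0 ∧ (T i).sum = 0) ∧ ∑ i, T i ≤ S

/-- The `r`-wise Davenport constant `D_r(G)`: the least positive integer `k` such that every
sequence over `G` of length at least `k` has `r` disjoint nonempty zero-sum subsequences. -/
noncomputable def rDavenport (G : Type*) [AddCommGroup G] (r : ℕ) : ℕ :=
  sInf {k : ℕ | 0 < k ∧ ∀ S : Multiset G, k ≤ Multiset.card S → HasDisjointZeroSums r S}

/-- For a finite group the set in the definition of `rDavenport` is nonempty, so the least
element is attained. -/
theorem rDavenport_isLeast (G : Type*) [AddCommGroup G] [Finite G] (r : ℕ) :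
    IsLeast {k : ℕ | 0 < k ∧ ∀ S : Multiset G, k ≤ Multiset.card S → HasDisjointZeroSums r S}
      (rDavenport G r) := by
  classical
  have := Fintype.ofFinite G
  have hne : {k : ℕ | 0 < k ∧ ∀ S : Multiset G, k ≤ Multiset.card S →
      HasDisjointZeroSums r S}.Nonempty := by
    refine ⟨Fintype.card G * (r * Fintype.card G) + 1, Nat.succ_pos _, fun S hS => ?_⟩
    obtain ⟨g, hg⟩ : ∃ g : G, r * Fintype.card G ≤ S.count g := by
      by_contra! h
      have h1 : ∑ g : G, S.count g ≤ ∑ _g : G, r * Fintype.card G :=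
        Finset.sum_le_sum fun g _ => (h g).le
      rw [Multiset.sum_count_eq_card (fun a _ => Finset.mem_univ a)] at h1
      simp only [Finset.sum_const, Finset.card_univ, smul_eq_mul] at h1
      omega
    refine ⟨fun _ => Multiset.replicate (Fintype.card G) g, fun _ => ⟨?_, ?_⟩, ?_⟩
    · intro h
      have h2 := congrArg Multiset.card h
      simp at h2
    · simp
    · rw [Finset.sum_const, Finset.card_univ, Fintype.card_fin, Multiset.nsmul_replicate]
      exact Multiset.le_count_iff_replicate_le.mp hg
  exact ⟨Nat.sInf_mem hne, fun k hk => Nat.sInf_le hk⟩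

/-! Upper bound (inductive method): let `K` be generated by `p ^ f • u` and `p ^ E • v`, where `u`,
`v` are the generators of the last two factors; these multiples are killed by `m` and `n`. Modulo
`K` the group is a quotient of a `p`-group of type `p ^ e i`. Olson's theorem bounds its Davenport
constant, and the hypothesis that `p ^ E` is large upgrades this to short blocks: a long enough
sequence has a block of length at most `p ^ E` with sum in `K` (`short_of_closure`). Peeling off
blocks gives `r * n + m - 1` of them when `m ∣ n`. Their sums lie in `K`, and the rank two bound
(`rank_two`), itself proved by the same device one prime at a time, groups them into `r` zero-sum
sequences.

Lower bound: take `r * ord - 1` copies of one of the last two generators and `ord - 1` copies of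
every other generator. Independence forces each zero-sum subsequence to use `ord` copies of the
first. -/

open Finset in
/-- Powers of a finite sum of nilpotent ideals vanish past the sum of the exponents. -/
theorem Ideal.sum_pow_eq_bot {A ι : Type*} [CommRing A] (I : ι → Ideal A) (n : ι → ℕ)
    (hI : ∀ i, I i ^ (n i + 1) = ⊥) (s : Finset ι) :
    (∑ i ∈ s, I i) ^ (∑ i ∈ s, n i + 1) = ⊥ := by
  classical
  induction s using Finset.induction_on with
  | empty => simp
  | insert a s ha ih =>
    rw [Finset.sum_insert ha, Finset.sum_insert ha, add_pow]
    refine Finset.sum_eq_zero fun k hk => ?_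
    rcases le_or_gt (n a + 1) k with h | h
    · rw [← Nat.add_sub_cancel' h, pow_add, hI]
      simp
    · have h2 : ∑ i ∈ s, n i + 1 ≤ n a + ∑ i ∈ s, n i + 1 - k := by omega
      rw [← Nat.add_sub_cancel' h2, pow_add (∑ i ∈ s, I i), ih]
      simp

/-! ### Lifting subsequences along a map -/

theorem Multiset.exists_le_map_eq {α β : Type*} {f : α → β} {S : Multiset α} {T : Multiset β}
    (h : T ≤ S.map f) : ∃ T' ≤ S, T'.map f = T := by
  induction T using Multiset.induction_on generalizing S with
  | empty => exact ⟨0, Multiset.zero_le _, rfl⟩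
  | cons t T ih =>
    obtain ⟨s, hs, rfl⟩ := Multiset.mem_map.mp
      (Multiset.mem_of_le h (Multiset.mem_cons_self t T))
    obtain ⟨S', rfl⟩ := Multiset.exists_cons_of_mem hs
    rw [Multiset.map_cons, Multiset.cons_le_cons_iff] at h
    obtain ⟨T', hT', rfl⟩ := ih h
    exact ⟨s ::ₘ T', (Multiset.cons_le_cons_iff s).mpr hT', by simp⟩

/-- Disjointness survives the lift, so blocks found among images or among sums of blocks pull back
to disjoint blocks of the original sequence. -/
theorem Multiset.exists_sum_le_map_eq {α β : Type*} {f : α → β} {S : Multiset α}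
    {F : Multiset (Multiset β)} (h : F.sum ≤ S.map f) :
    ∃ F' : Multiset (Multiset α), F'.sum ≤ S ∧ F'.map (Multiset.map f) = F := by
  induction F using Multiset.induction_on generalizing S with
  | empty => exact ⟨0, by simp, rfl⟩
  | cons T F ih =>
    rw [Multiset.sum_cons] at h
    obtain ⟨T', hT', rfl⟩ := Multiset.exists_le_map_eq ((Multiset.le_add_right _ _).trans h)
    obtain ⟨S', rfl⟩ := Multiset.le_iff_exists_add.mp hT'
    rw [Multiset.map_add, Multiset.add_le_add_iff_left] at h
    obtain ⟨F', hF', rfl⟩ := ih h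
    exact ⟨T' ::ₘ F', by simpa using hF', by simp⟩

theorem Multiset.exists_le_card_eq_of_le {α : Type*} {S : Multiset α} {n : ℕ}
    (h : n ≤ Multiset.card S) : ∃ T ≤ S, Multiset.card T = n := by
  have h1 : 0 < Multiset.card (Multiset.powersetCard n S) := by
    rw [Multiset.card_powersetCard]
    exact Nat.choose_pos h
  obtain ⟨T, hT⟩ := Multiset.card_pos_iff_exists_mem.mp h1
  exact ⟨T, Multiset.mem_powersetCard.mp hT⟩

/-! ### Olson's theorem via the group algebra -/

open AddMonoidAlgebra in
/-- Olson's theorem for an abelian group generated by elements of prime power order. -/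
theorem exists_zeroSum_of_closure {p : ℕ} [Fact p.Prime] {Q ι α : Type*} [AddCommGroup Q]
    [Fintype ι] (g : ι → Q) (e : ι → ℕ) (hg : ∀ i, p ^ e i • g i = 0) (f : α → Q)
    (S : Multiset α) (hS : ∀ x ∈ S, f x ∈ AddSubgroup.closure (Set.range g))
    (hc : ∑ i, (p ^ e i - 1) + 1 ≤ Multiset.card S) :
    ∃ T ≤ S, T ≠ 0 ∧ (T.map f).sum = 0 := by
  classical
  obtain ⟨l, rfl⟩ := Quot.exists_rep S
  change ∀ x ∈ (l : Multiset α), _ at hS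
  change _ ≤ Multiset.card (l : Multiset α) at hc
  change ∃ T ≤ (l : Multiset α), _
  -- Indexing by positions keeps repeated terms apart, so subsequences become subsets of `Fin
  -- l.length`.
  have hl : (l : Multiset α) = (Finset.univ : Finset (Fin l.length)).val.map l.get := by
    simp
  rw [hl] at hS hc ⊢
  by_contra! hcon
  have : CharP (AddMonoidAlgebra (ZMod p) Q) p :=
    charP_of_injective_algebraMap (algebraMap (ZMod p) _).injective p
  set J : Ideal (AddMonoidAlgebra (ZMod p) Q) :=
    ∑ i, Ideal.span {single (g i) (1 : ZMod p) - 1} with hJ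
  have hJpow : J ^ (∑ i, (p ^ e i - 1) + 1) = ⊥ := by
    refine Ideal.sum_pow_eq_bot _ _ (fun i => ?_) _
    -- Frobenius in characteristic `p`: (X^g - 1)^(p^e) = X^(p^e g) - 1 = 0.
    rw [Nat.sub_add_cancel (Nat.one_le_pow _ _ (Fact.out : p.Prime).pos), Ideal.span_singleton_pow,
      sub_pow_char_pow, single_pow, hg]
    simp [one_def]
  have hmem : ∀ x ∈ AddSubgroup.closure (Set.range g), single x (1 : ZMod p) - 1 ∈ J := by
    intro x hx
    induction hx using AddSubgroup.closure_induction with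
    | mem x hx =>
      obtain ⟨i, rfl⟩ := hx
      have : Ideal.span {single (g i) (1 : ZMod p) - 1} ≤ J :=
        Finset.single_le_sum (f := fun i => Ideal.span {single (g i) (1 : ZMod p) - 1})
          (fun _ _ => bot_le) (Finset.mem_univ i)
      exact this (Ideal.subset_span rfl)
    | zero => simp [one_def]
    | add x y _ _ hx hy =>
      have : single (x + y) (1 : ZMod p) - 1
          = single x (1 : ZMod p) * (single y (1 : ZMod p) - 1) + (single x (1 : ZMod p) - 1) := by
        rw [mul_sub, single_mul_single]
        simp
      rw [this]
      exact J.add_mem (J.mul_mem_left _ hy) hx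
    | neg x _ hx =>
      have : single (-x) (1 : ZMod p) - 1
          = -single (-x) (1 : ZMod p) * (single x (1 : ZMod p) - 1) := by
        rw [mul_sub, neg_mul, single_mul_single]
        simp [one_def, sub_eq_neg_add, add_comm]
      rw [this]
      exact J.mul_mem_left _ hx
  -- Each factor 1 - X^(f x) lies in `J`, and there are enough factors to exceed the nilpotency
  -- exponent.
  have hprod : ∏ i : Fin l.length, (single (f (l.get i)) (-1 : ZMod p) + 1) = 0 := by
    have h1 : ∏ i : Fin l.length, (single (f (l.get i)) (-1 : ZMod p) + 1)
        ∈ ∏ _i : Fin l.length, J := by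
      refine Ideal.prod_mem_prod fun i _ => ?_
      have h2 := hmem (f (l.get i)) (hS _ (Multiset.mem_map_of_mem _ (Finset.mem_univ i)))
      have h3 : single (f (l.get i)) (-1 : ZMod p) + 1 = -(single (f (l.get i)) (1 : ZMod p) - 1) := by
        rw [neg_sub, sub_eq_add_neg, add_comm, ← single_neg]
      rw [h3]
      exact J.neg_mem h2
    rw [Finset.prod_const] at h1
    have h4 : J ^ (Finset.univ : Finset (Fin l.length)).card
        ≤ J ^ (∑ i, (p ^ e i - 1) + 1) := Ideal.pow_le_pow_right (by simpa using hc)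
    rw [hJpow] at h4
    exact h4 h1
  have hterm : ∀ t : Finset (Fin l.length),
      ∏ i ∈ t, single (f (l.get i)) (-1 : ZMod p)
        = single (∑ i ∈ t, f (l.get i)) ((-1) ^ t.card) := by
    intro t
    induction t using Finset.induction_on with
    | empty => simp [one_def]
    | insert a t ha ih =>
      rw [Finset.prod_insert ha, ih, single_mul_single, Finset.sum_insert ha,
        Finset.card_insert_of_notMem ha, pow_succ']
  rw [Finset.prod_add] at hprod
  have h5 := congrArg (fun x => (coeffAddEquiv x) 0) hprod
  simp only [map_sum, Finset.prod_const_one, mul_one, hterm, Finsupp.finsetSum_apply] at h5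
  -- With no nonempty zero-sum subset, only the empty one contributes to the coefficient at 0, which
  -- is then 1 rather than 0.
  rw [Finset.sum_eq_single ∅] at h5
  · simp at h5
  · intro t _ ht
    have h6 := hcon (t.val.map l.get) (Multiset.map_le_map (Finset.val_le_iff.mpr
      (Finset.subset_univ t))) (by simpa using ht)
    rw [Multiset.map_map] at h6
    simp only [coeffAddEquiv_apply, coeff_single]
    exact Finsupp.single_eq_of_ne (Ne.symm h6)
  · simp

/-! ### Calculus of zero-sum bounds -/

/-- Every sequence over `L` of length at least `l` has `r` disjoint nonempty subsequences of
length at most `c` with sum in `K`. -/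
def ZeroSumBound {G : Type*} [AddCommGroup G] (L K : AddSubgroup G) (r l c : ℕ) : Prop :=
  ∀ S : Multiset G, (∀ x ∈ S, x ∈ L) → l ≤ Multiset.card S →
    ∃ F : Multiset (Multiset G), Multiset.card F = r ∧
      (∀ T ∈ F, T ≠ 0 ∧ T.sum ∈ K ∧ Multiset.card T ≤ c) ∧ F.sum ≤ S

namespace ZeroSumBound

variable {G : Type*} [AddCommGroup G] {L K M : AddSubgroup G} {r l c N c' l' : ℕ}

theorem one_iff : ZeroSumBound L K 1 l c ↔ ∀ S : Multiset G, (∀ x ∈ S, x ∈ L) →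
    l ≤ Multiset.card S → ∃ T ≤ S, T ≠ 0 ∧ T.sum ∈ K ∧ Multiset.card T ≤ c := by
  refine forall_congr' fun S => imp_congr_right fun _ => imp_congr_right fun _ => ?_
  constructor
  · rintro ⟨F, hF, h, hle⟩
    obtain ⟨T, rfl⟩ := Multiset.card_eq_one.mp hF
    exact ⟨T, by simpa using hle, h T (by simp)⟩
  · rintro ⟨T, hle, h⟩
    exact ⟨{T}, by simp, by simpa using h, by simpa using hle⟩

theorem mono (h : ZeroSumBound L K r l c) (hl : l ≤ l') (hc : c ≤ c') :
    ZeroSumBound L K r l' c' := fun S hS hcard => by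
  obtain ⟨F, h1, h2, h3⟩ := h S hS (hl.trans hcard)
  exact ⟨F, h1, fun T hT => ⟨(h2 T hT).1, (h2 T hT).2.1, (h2 T hT).2.2.trans hc⟩, h3⟩

/-- The sums of the blocks with sum in `K` form a sequence over `K`; grouping these sums and merging
the corresponding blocks multiplies the lengths. -/
theorem comp (h : ZeroSumBound L K N l c) (h' : ZeroSumBound K M r N c') :
    ZeroSumBound L M r l (c' * c) := by
  intro S hS hcard
  obtain ⟨F, hF, hT, hle⟩ := h S hS hcard
  obtain ⟨F', hF', hT', hle'⟩ := h' (F.map Multiset.sum)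
    (fun x hx => by
      obtain ⟨T, hTF, rfl⟩ := Multiset.mem_map.mp hx
      exact (hT T hTF).2.1) (by simp [hF])
  obtain ⟨E, hE, rfl⟩ := Multiset.exists_sum_le_map_eq hle'
  refine ⟨E.map Multiset.sum, by simpa using hF', ?_, ?_⟩
  · intro T hTE
    obtain ⟨U, hU, rfl⟩ := Multiset.mem_map.mp hTE
    obtain ⟨h1, h2, h3⟩ := hT' _ (Multiset.mem_map_of_mem _ hU)
    have hUF : ∀ T ∈ U, T ∈ F := fun T hTU =>
      Multiset.mem_of_le ((Multiset.single_le_sum (fun _ _ => Multiset.zero_le _) U hU).trans hE)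
        hTU
    refine ⟨?_, ?_, ?_⟩
    · obtain ⟨T, hTU⟩ := Multiset.exists_mem_of_ne_zero (by simpa using h1 : U ≠ 0)
      intro h0
      exact (hT T (hUF T hTU)).1 (Multiset.le_zero.mp (h0 ▸
        Multiset.single_le_sum (fun _ _ => Multiset.zero_le _) T hTU))
    · have : U.sum.sum = (U.map Multiset.sum).sum := by
        simpa using map_multiset_sum (Multiset.sumAddMonoidHom : Multiset G →+ G) U
      rwa [this]
    · have h4 : Multiset.card U.sum = (U.map Multiset.card).sum := by
        simpa using map_multiset_sum (Multiset.cardHom : Multiset G →+ ℕ) U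
      rw [h4]
      refine (Multiset.sum_le_card_nsmul _ c fun x hx => ?_).trans ?_
      · obtain ⟨T, hTU, rfl⟩ := Multiset.mem_map.mp hx
        exact (hT T (hUF T hTU)).2.2
      · simp only [Multiset.card_map, smul_eq_mul] at h3 ⊢
        exact Nat.mul_le_mul_right _ h3
  · have : (E.map Multiset.sum).sum = E.sum.sum := by
      simpa using (map_multiset_sum
        (Multiset.sumAddMonoidHom : Multiset (Multiset G) →+ Multiset G) E).symm
    rw [this]
    obtain ⟨R, rfl⟩ := Multiset.le_iff_exists_add.mp hE
    rw [Multiset.sum_add] at hle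
    exact (Multiset.le_add_right _ _).trans hle

/-- Peel off short subsequences one at a time. -/
theorem iterate (h : ZeroSumBound L K 1 l c) (h' : ZeroSumBound L K 1 l' c') (hl : l ≤ l' + c)
    (hc : c ≤ c') (N : ℕ) : ZeroSumBound L K (N + 1) (N * c + l') c' := by
  classical
  induction N with
  | zero => simpa using h'
  | succ N ih =>
    intro S hS hcard
    rw [add_mul, one_mul] at hcard
    obtain ⟨T, hTS, hT0, hTK, hTc⟩ := one_iff.mp h S hS (by omega)
    obtain ⟨R, rfl⟩ := Multiset.le_iff_exists_add.mp hTS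
    rw [Multiset.card_add] at hcard
    obtain ⟨F, h1, h2, h3⟩ := ih R (fun x hx => hS x (Multiset.mem_add.mpr (.inr hx))) (by omega)
    refine ⟨T ::ₘ F, by simp [h1], ?_, by simpa using h3⟩
    intro U hU
    rcases Multiset.mem_cons.mp hU with rfl | hU
    · exact ⟨hT0, hTK, hTc.trans hc⟩
    · exact h2 U hU

theorem iterate_exists (h : ZeroSumBound L K 1 l c) (h' : ∃ c', ZeroSumBound L K 1 l' c')
    (hl : l ≤ l' + c) (N : ℕ) : ∃ c', ZeroSumBound L K (N + 1) (N * c + l') c' := by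
  obtain ⟨c', h'⟩ := h'
  exact ⟨_, h.iterate (h'.mono le_rfl (le_max_left c' c)) hl (le_max_right c' c) N⟩

theorem hasDisjointZeroSums (h : ZeroSumBound (⊤ : AddSubgroup G) ⊥ r l c) (S : Multiset G)
    (hS : l ≤ Multiset.card S) : HasDisjointZeroSums r S := by
  obtain ⟨F, rfl, h2, h3⟩ := h S (by simp) hS
  obtain ⟨L, rfl⟩ := Quot.exists_rep F
  refine ⟨L.get, fun i => ?_, ?_⟩
  · have := h2 (L.get i) (List.get_mem L i)
    exact ⟨this.1, by simpa using this.2.1⟩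
  · have h4 : ∑ i, L.get i = L.sum := by
      rw [← List.sum_ofFn, List.ofFn_get]
    exact (h4.trans (Multiset.sum_coe L).symm).trans_le h3

/-! ### Bounds modulo `K` when the quotient is a `p`-group -/

theorem davenport_of_closure {p : ℕ} [Fact p.Prime] {ι : Type*} [Fintype ι] (g : ι → G)
    (e : ι → ℕ) (hg : ∀ i, p ^ e i • g i ∈ K) :
    ZeroSumBound (AddSubgroup.closure (Set.range g)) K 1 (∑ i, (p ^ e i - 1) + 1)
      (∑ i, (p ^ e i - 1) + 1) := by
  rw [one_iff]
  intro S hS hcard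
  obtain ⟨S', hS', hcard'⟩ := Multiset.exists_le_card_eq_of_le hcard
  obtain ⟨T, hT, hT0, hTs⟩ := exists_zeroSum_of_closure (p := p)
    (fun i => QuotientAddGroup.mk' K (g i)) e
    (fun i => by rw [← map_nsmul]; exact (QuotientAddGroup.eq_zero_iff _).mpr (hg i)) (QuotientAddGroup.mk' K) S'
    (fun x hx => by
      have := AddSubgroup.mem_map_of_mem (QuotientAddGroup.mk' K)
        (hS x (Multiset.mem_of_le hS' hx))
      rwa [AddMonoidHom.map_closure, ← Set.range_comp] at this) hcard'.ge
  refine ⟨T, hT.trans hS', hT0, ?_, (Multiset.card_le_card hT).trans hcard'.le⟩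
  rw [← map_multiset_sum] at hTs
  simpa using hTs

/-- Appending a coordinate 1 in `ZMod (p ^ E)` to every term makes Olson's theorem return a block
whose length is a multiple of `p ^ E`. By `hE` this length is below `3 * p ^ E`, and a block of
length `2 * p ^ E` can be split in two. -/
theorem short_of_closure {p : ℕ} [Fact p.Prime] {ι : Type*} [Fintype ι] (g : ι → G)
    (e : ι → ℕ) (hg : ∀ i, p ^ e i • g i ∈ K) (E : ℕ)
    (hE : ∑ i, (p ^ e i - 1) + 2 ≤ 2 * p ^ E) :
    ZeroSumBound (AddSubgroup.closure (Set.range g)) K 1 (∑ i, (p ^ e i - 1) + p ^ E)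
      (p ^ E) := by
  classical
  have hpos : 0 < p ^ E := Nat.pow_pos (Fact.out : p.Prime).pos
  rw [one_iff]
  intro S hS hcard
  obtain ⟨S', hS', hcard'⟩ := Multiset.exists_le_card_eq_of_le hcard
  let g' : Option ι → (G ⧸ K) × ZMod (p ^ E) :=
    fun o => o.elim (0, 1) fun i => (QuotientAddGroup.mk' K (g i), 0)
  obtain ⟨T, hT, hT0, hTs⟩ := exists_zeroSum_of_closure (p := p) g' (fun o => o.elim E e)
    (fun o => by
      cases o with
      | none => 
        refine Prod.ext (by simp [g']) ?_
        simp only [g', Option.elim, Prod.smul_snd, nsmul_eq_mul, mul_one, Prod.snd_zero]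
        exact ZMod.natCast_self _
      | some i =>
        refine Prod.ext ?_ (by simp [g'])
        simp only [g', Option.elim, Prod.smul_fst, Prod.fst_zero]
        rw [← map_nsmul]; exact (QuotientAddGroup.eq_zero_iff _).mpr (hg i))
    (fun x => (QuotientAddGroup.mk' K x, (1 : ZMod (p ^ E)))) S'
    (fun x hx => by
      have h1 := AddSubgroup.mem_map_of_mem
        ((AddMonoidHom.inl (G ⧸ K) (ZMod (p ^ E))).comp (QuotientAddGroup.mk' K))
        (hS x (Multiset.mem_of_le hS' hx))
      rw [AddMonoidHom.map_closure, ← Set.range_comp] at h1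
      have h2 : ((QuotientAddGroup.mk' K x, 0) : (G ⧸ K) × ZMod (p ^ E)) ∈
          AddSubgroup.closure (Set.range g') := by
        refine AddSubgroup.closure_mono ?_ h1
        rintro _ ⟨i, rfl⟩
        exact ⟨some i, rfl⟩
      have h3 := AddSubgroup.add_mem _ h2
        (AddSubgroup.subset_closure (⟨none, rfl⟩ : g' none ∈ Set.range g'))
      simpa [g'] using h3)
    (by
      rw [Fintype.sum_option, hcard']
      simp only [Option.elim]
      omega)
  have hTK : T.sum ∈ K := by
    have h1 := congrArg (AddMonoidHom.fst (G ⧸ K) (ZMod (p ^ E))) hTs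
    rw [map_multiset_sum, Multiset.map_map] at h1
    have h2 : (T.map (QuotientAddGroup.mk' K)).sum = 0 := h1
    rw [← map_multiset_sum] at h2
    simpa using h2
  have hdvd : p ^ E ∣ Multiset.card T := by
    have h1 := congrArg (AddMonoidHom.snd (G ⧸ K) (ZMod (p ^ E))) hTs
    rw [map_multiset_sum, Multiset.map_map] at h1
    have h2 : (T.map (fun _ => (1 : ZMod (p ^ E)))).sum = 0 := h1
    rw [Multiset.map_const', Multiset.sum_replicate, nsmul_one] at h2
    exact (ZMod.natCast_eq_zero_iff _ _).mp h2
  have hTS := hT.trans hS'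
  have hTcard := Multiset.card_le_card hT
  obtain ⟨k, hk⟩ := hdvd
  rcases le_or_gt k 1 with hk1 | hk1
  · exact ⟨T, hTS, hT0, hTK, hk.trans_le (by nlinarith)⟩
  have hk2 : Multiset.card T = 2 * p ^ E := by
    have : k = 2 := by
      by_contra hne
      have h3 : 3 ≤ k := by omega
      have := Nat.mul_le_mul_left (p ^ E) h3
      omega
    rw [hk, this, mul_comm]
  -- Setting `a` aside leaves enough terms for the Davenport bound and guarantees that the
  -- complement of the block `U` found is nonempty; either `U` or its complement is short.
  obtain ⟨a, ha⟩ := Multiset.exists_mem_of_ne_zero hT0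
  obtain ⟨R, rfl⟩ := Multiset.exists_cons_of_mem ha
  rw [Multiset.card_cons] at hk2
  obtain ⟨U, hU, hU0, hUK, -⟩ := one_iff.mp (davenport_of_closure g e hg) R
    (fun x hx => hS x (Multiset.mem_of_le hTS (Multiset.mem_cons_of_mem hx))) (by omega)
  obtain ⟨V, rfl⟩ := Multiset.le_iff_exists_add.mp hU
  rw [Multiset.card_add] at hk2
  rcases le_or_gt (Multiset.card U) (p ^ E) with h | h
  · exact ⟨U, (hU.trans (Multiset.le_cons_self _ _)).trans hTS, hU0, hUK, h⟩
  · refine ⟨a ::ₘ V, le_trans ((Multiset.cons_le_cons_iff a).mpr (Multiset.le_add_left V U)) hTS,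
      Multiset.cons_ne_zero, ?_, ?_⟩
    · rw [Multiset.sum_cons, Multiset.sum_add, add_left_comm] at hTK
      rw [Multiset.sum_cons]
      exact (AddSubgroup.add_mem_cancel_left K hUK).mp hTK
    · rw [Multiset.card_cons]
      omega

theorem of_closure_le {g : Set G} (h : g ⊆ K) : ZeroSumBound (AddSubgroup.closure g) K 1 1 1 := by
  rw [one_iff]
  intro S hS hcard
  obtain ⟨x, hx⟩ := Multiset.card_pos_iff_exists_mem.mp hcard
  exact ⟨{x}, by simpa using hx, by simp,
    by simpa using (AddSubgroup.closure_le K).mpr h (hS x hx), by simp⟩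

/-! ### Cyclic and rank two groups -/

theorem cyclic (k : ℕ) : 0 < k → ∀ (g : Fin 1 → G), (∀ i, k • g i ∈ K) →
    ZeroSumBound (AddSubgroup.closure (Set.range g)) K 1 k k := by
  induction k using induction_on_primes with
  | zero => simp
  | one =>
    intro _ g hg
    exact of_closure_le (by rintro _ ⟨i, rfl⟩; simpa using hg i)
  | prime_mul p a hp ih =>
    intro hpos g hg
    have : Fact p.Prime := ⟨hp⟩
    have ha : 0 < a := Nat.pos_of_mul_pos_left hpos
    have h1 := ih ha (fun i => p • g i) fun i => mul_nsmul (g i) p a ▸ hg i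
    have h2 := davenport_of_closure (p := p) (K := AddSubgroup.closure (Set.range fun i => p • g i))
      g (fun _ => 1) fun i => by simpa using AddSubgroup.subset_closure (Set.mem_range_self i)
    have hp' : ∑ _i : Fin 1, (p ^ 1 - 1) + 1 = p := by simp [Nat.sub_add_cancel hp.one_le]
    rw [hp'] at h2
    have h3 := h2.iterate h2 (by omega) le_rfl (a - 1)
    rw [Nat.sub_add_cancel ha] at h3
    refine (h3.comp h1).mono ?_ (mul_comm _ _).le
    obtain ⟨b, rfl⟩ := Nat.exists_eq_add_of_lt ha
    simp; nlinarith

/-- The two bounds are proved together: for `p * a`, short blocks modulo the multiples of `p` are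
peeled off until their sums suffice for the case `a`. -/
theorem rank_two_square (m : ℕ) : 0 < m → ∀ (g : Fin 2 → G), (∀ i, m • g i ∈ K) →
    (∃ c, ZeroSumBound (AddSubgroup.closure (Set.range g)) K 1 (2 * m - 1) c) ∧
      ZeroSumBound (AddSubgroup.closure (Set.range g)) K 1 (3 * m - 2) m := by
  induction m using induction_on_primes with
  | zero => simp
  | one =>
    intro _ g hg
    have := of_closure_le (K := K) (g := Set.range g) (by rintro _ ⟨i, rfl⟩; simpa using hg i)
    exact ⟨⟨1, this⟩, this⟩
  | prime_mul p a hp ih =>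
    intro hpos g hg
    have : Fact p.Prime := ⟨hp⟩
    have ha : 0 < a := Nat.pos_of_mul_pos_left hpos
    have hp1 := hp.one_le
    obtain ⟨⟨c, h1⟩, h1'⟩ := ih ha (fun i => p • g i) fun i => mul_nsmul (g i) p a ▸ hg i
    have hM : ∀ i, p ^ 1 • g i ∈ AddSubgroup.closure (Set.range fun i => p • g i) := fun i => by
      simpa using AddSubgroup.subset_closure (Set.mem_range_self i)
    have h2 := davenport_of_closure g (fun _ => 1) hM
    have h2' := short_of_closure g (fun _ => 1) hM 1 (by simp; omega)
    simp only [pow_one, Finset.sum_const, Finset.card_univ, Fintype.card_fin, smul_eq_mul]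
      at h2 h2'
    have hap : p ≤ p * a := Nat.le_mul_of_pos_right _ ha
    constructor
    · obtain ⟨c', h3⟩ := h2'.iterate_exists ⟨_, h2⟩ (by omega) (2 * a - 1 - 1)
      rw [Nat.sub_add_cancel (by omega)] at h3
      refine ⟨_, (h3.comp h1).mono ?_ le_rfl⟩
      obtain ⟨b, rfl⟩ := Nat.exists_eq_add_of_lt ha
      obtain ⟨q, rfl⟩ := Nat.exists_eq_add_of_le hp1
      have e1 : 2 * (0 + b + 1) - 1 - 1 = 2 * b := by omega
      have e2 : 1 + q - 1 = q := by omega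
      rw [e1, e2]
      apply Nat.le_sub_of_add_le
      nlinarith
    · have h3 := h2'.iterate h2' (by omega) le_rfl (3 * a - 2 - 1)
      rw [Nat.sub_add_cancel (by omega)] at h3
      refine (h3.comp h1').mono ?_ (mul_comm _ _).le
      obtain ⟨b, rfl⟩ := Nat.exists_eq_add_of_lt ha
      obtain ⟨q, rfl⟩ := Nat.exists_eq_add_of_le hp1
      have e1 : 3 * (0 + b + 1) - 2 - 1 = 3 * b := by omega
      have e2 : 1 + q - 1 = q := by omega
      rw [e1, e2]
      apply Nat.le_sub_of_add_le
      nlinarith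

theorem rank_two {m n : ℕ} (hm : 0 < m) (hn : 0 < n) (hmn : m ∣ n) (hr : 0 < r) (u v : G)
    (hu : m • u = 0) (hv : n • v = 0) :
    ∃ c, ZeroSumBound (AddSubgroup.closure {u, v}) ⊥ r (r * n + m - 1) c := by
  obtain ⟨k, rfl⟩ := hmn
  have hk : 0 < k := Nat.pos_of_mul_pos_left hn
  have hrange : Set.range ![u, v] = {u, v} := by simp [Set.pair_comm]
  -- Modulo the cyclic group generated by `m • v` both generators are killed by `m`; that subgroup
  -- is itself killed by `k = n / m`.
  obtain ⟨h1, h1'⟩ := rank_two_square (K := AddSubgroup.closure (Set.range fun _ : Fin 1 => m • v))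
    m hm ![u, v] (fun i => by
      fin_cases i
      · simp [hu]
      · simp)
  rw [hrange] at h1 h1'
  have h2 := cyclic (K := (⊥ : AddSubgroup G)) k hk (fun _ => m • v)
    fun _ => by rwa [← mul_nsmul]
  have h3 := h1'.iterate h1' (by omega) le_rfl (k - 1)
  obtain ⟨c, h4⟩ := h1'.iterate_exists h1 (by omega) (k - 1)
  rw [Nat.sub_add_cancel hk] at h3 h4
  have hmk : (k - 1) * m + m = m * k := by
    rw [← Nat.succ_mul, Nat.succ_eq_add_one, Nat.sub_add_cancel hk, mul_comm]
  have hmk' : k * m = m * k := mul_comm _ _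
  have h5 := h3.comp h2
  rw [hmk'] at h5
  have hle : m ≤ m * k := Nat.le_mul_of_pos_right _ hk
  -- `h5` peels off `r - 1` zero-sum blocks of length at most `n`; the last one needs only `n + m -
  -- 1` terms and no length control.
  obtain ⟨c', h6⟩ := h5.iterate_exists ⟨_, h4.comp h2⟩ (by omega) (r - 1)
  rw [Nat.sub_add_cancel hr] at h6
  refine ⟨c', h6.mono ?_ le_rfl⟩
  have : (r - 1) * (m * k) + m * k = r * (m * k) := by
    rw [← Nat.succ_mul, Nat.succ_eq_add_one, Nat.sub_add_cancel hr]
  omega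

end ZeroSumBound

/-! ### Lower bound from independent generators -/

/-- If the relations among the `g i` are generated by `n i • g i = 0`, then a sequence made of
`c i` copies of each `g i`, with `c i < n i` except that `c i₀ < r * n i₀`, does not have `r`
disjoint zero-sum subsequences. -/
theorem not_hasDisjointZeroSums {G ι : Type*} [AddCommGroup G] [Fintype ι] [DecidableEq ι]
    (g : ι → G) (n : ι → ℕ) (hg : ∀ j : ι → ℕ, ∑ i, j i • g i = 0 → ∀ i, n i ∣ j i) (i₀ : ι)
    (r : ℕ) (S : Multiset ι) (hS : ∀ i ≠ i₀, S.count i < n i) (hS₀ : S.count i₀ < r * n i₀) :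
    ¬ HasDisjointZeroSums r (S.map g) := by
  rintro ⟨T, hT, hle⟩
  -- Work with multisets of indices, since `g` need not be injective.
  obtain ⟨F, hF, hFT⟩ := Multiset.exists_sum_le_map_eq (F := Finset.univ.val.map T) hle
  have hcard : Multiset.card F = r := by
    simpa using congrArg Multiset.card hFT
  have hcount : ∀ U ∈ F, n i₀ ≤ U.count i₀ := by
    intro U hU
    obtain ⟨k, -, hk⟩ := Multiset.mem_map.mp (hFT ▸ Multiset.mem_map_of_mem (Multiset.map g) hU)
    obtain ⟨h0, hsum⟩ := hT k
    rw [hk] at h0 hsum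
    have hUS : U ≤ S := (Multiset.single_le_sum (fun _ _ => Multiset.zero_le _) U hU).trans hF
    have hdvd := hg (fun i => U.count i) (by
      rw [Finset.sum_multiset_map_count] at hsum
      rw [← hsum]
      exact (Finset.sum_subset (Finset.subset_univ _) fun i _ hi => by
        rw [Multiset.count_eq_zero_of_notMem (by simpa using hi), zero_smul]).symm)
    have hz : ∀ i ≠ i₀, U.count i = 0 := fun i hi =>
      Nat.eq_zero_of_dvd_of_lt (hdvd i) ((Multiset.count_le_of_le i hUS).trans_lt (hS i hi))
    refine Nat.le_of_dvd (Nat.pos_of_ne_zero fun hz₀ => h0 ?_) (hdvd i₀)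
    rw [Multiset.map_eq_zero]
    ext i
    by_cases hi : i = i₀
    · rw [hi, hz₀, Multiset.count_zero]
    · rw [hz i hi, Multiset.count_zero]
  have h1 : F.sum.count i₀ = (F.map (Multiset.count i₀)).sum := by
    simpa using map_multiset_sum (Multiset.countAddMonoidHom i₀) F
  have h2 := Multiset.card_nsmul_le_sum (s := F.map (Multiset.count i₀)) (a := n i₀) (by
    intro x hx
    obtain ⟨U, hU, rfl⟩ := Multiset.mem_map.mp hx
    exact hcount U hU)
  rw [Multiset.card_map, hcard, smul_eq_mul, ← h1] at h2
  have h3 := Multiset.count_le_of_le i₀ hF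
  omega

theorem lt_rDavenport_of_relations {G ι : Type*} [AddCommGroup G] [Finite G] [Fintype ι]
    (g : ι → G) (n : ι → ℕ) (hn : ∀ i, 0 < n i)
    (hg : ∀ j : ι → ℕ, ∑ i, j i • g i = 0 → ∀ i, n i ∣ j i) (i₀ : ι) (r : ℕ) (hr : 0 < r) :
    (r - 1) * n i₀ + ∑ i, (n i - 1) < rDavenport G r := by
  classical
  by_contra! hcon
  let S : Multiset ι := Multiset.replicate ((r - 1) * n i₀) i₀ +
    ∑ i, Multiset.replicate (n i - 1) i
  have hcount : ∀ i, S.count i = (if i = i₀ then (r - 1) * n i₀ else 0) + (n i - 1) := by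
    intro i
    simp [S, Multiset.count_sum', Multiset.count_replicate, eq_comm]
  refine not_hasDisjointZeroSums g n hg i₀ r S (fun i hi => ?_) ?_
    ((rDavenport_isLeast G r).1.2 _ ?_)
  · have := hn i
    simp [hcount, hi, this]
  · have := hn i₀
    obtain ⟨s, rfl⟩ := Nat.exists_eq_add_of_lt hr
    rw [hcount, if_pos rfl, zero_add, Nat.add_sub_cancel, add_mul]
    omega
  · simpa [S] using hcon

theorem rDavenport_le {G : Type*} [AddCommGroup G] {r l c : ℕ} (hl : 0 < l)
    (h : ZeroSumBound (⊤ : AddSubgroup G) ⊥ r l c) : rDavenport G r ≤ l :=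
  Nat.sInf_le ⟨hl, h.hasDisjointZeroSums⟩

/-! ### Products of cyclic groups -/

section PrimePowerTimesRankTwo

variable {k : ℕ} (a : Fin k → ℕ) (b c : ℕ)

/-- The standard generators of a product of cyclic groups. -/
def stdGen : Option (Option (Fin k)) → ((i : Fin k) → ZMod (a i)) × ZMod b × ZMod c
  | none => (0, 0, 1)
  | some none => (0, 1, 0)
  | some (some i) => (Pi.single i 1, 0, 0)

/-- The orders of the standard generators of a product of cyclic groups. -/
def stdOrder : Option (Option (Fin k)) → ℕ
  | none => c
  | some none => b
  | some (some i) => a i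

theorem sum_smul_stdGen (j : Option (Option (Fin k)) → ℕ) :
    ∑ i, j i • stdGen a b c i =
      (fun i => (j (some (some i)) : ZMod (a i)), (j (some none) : ZMod b), (j none : ZMod c)) := by
  rw [Fintype.sum_option, Fintype.sum_option]
  have h : ∑ i, j (some (some i)) • stdGen a b c (some (some i)) =
      (fun i => (j (some (some i)) : ZMod (a i)), 0, 0) := by
    refine Prod.ext ?_ (Prod.ext ?_ ?_)
    · rw [Prod.fst_sum]
      funext i
      rw [Finset.sum_apply, Finset.sum_eq_single i]
      · simp [stdGen]
      · intro i' _ hi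
        simp [stdGen, Pi.single_eq_of_ne' hi]
      · simp
    · simp [stdGen, Prod.snd_sum]
    · simp [stdGen, Prod.snd_sum]
  rw [h]
  simp [stdGen]

theorem stdOrder_dvd (j : Option (Option (Fin k)) → ℕ) (h : ∑ i, j i • stdGen a b c i = 0)
    (i : Option (Option (Fin k))) : stdOrder a b c i ∣ j i := by
  rw [sum_smul_stdGen] at h
  rcases i with - | - | i
  · exact (ZMod.natCast_eq_zero_iff _ _).mp (congrArg (fun x => x.2.2) h)
  · exact (ZMod.natCast_eq_zero_iff _ _).mp (congrArg (fun x => x.2.1) h)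
  · exact (ZMod.natCast_eq_zero_iff _ _).mp (congrFun (congrArg Prod.fst h) i)

theorem closure_stdGen (ha : ∀ i, 0 < a i) (hb : 0 < b) (hc : 0 < c) :
    AddSubgroup.closure (Set.range (stdGen a b c)) = ⊤ := by
  have := fun i => NeZero.of_pos (ha i)
  have := NeZero.of_pos hb
  have := NeZero.of_pos hc
  rw [eq_top_iff]
  rintro ⟨x, y, z⟩ -
  have h := sum_smul_stdGen a b c (fun o => match o with
    | none => z.val
    | some none => y.val
    | some (some i) => (x i).val)
  simp only [ZMod.natCast_val, ZMod.cast_id', id] at h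
  rw [← h]
  exact AddSubgroup.sum_mem _ fun i _ => AddSubgroup.nsmul_mem _
    (AddSubgroup.subset_closure (Set.mem_range_self i)) _

theorem smul_stdGen (i : Option (Option (Fin k))) : stdOrder a b c i • stdGen a b c i = 0 := by
  rcases i with - | - | i
  · simp [stdGen, stdOrder]
  · simp [stdGen, stdOrder]
  · refine Prod.ext ?_ (by simp [stdGen])
    simp [stdGen, stdOrder, ← Pi.single_smul]

/-- Either of the last two generators can play the repeated one; when `n ∣ m` either choice may win,
hence the maximum in the final statement. -/
theorem lt_rDavenport_prod (ha : ∀ i, 0 < a i) (hb : 0 < b) (hc : 0 < c) {r : ℕ} (hr : 0 < r) :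
    (r - 1) * c + (c - 1 + (b - 1 + ∑ i, (a i - 1))) <
        rDavenport (((i : Fin k) → ZMod (a i)) × ZMod b × ZMod c) r ∧
      (r - 1) * b + (c - 1 + (b - 1 + ∑ i, (a i - 1))) <
        rDavenport (((i : Fin k) → ZMod (a i)) × ZMod b × ZMod c) r := by
  have := fun i => NeZero.of_pos (ha i)
  have := NeZero.of_pos hb
  have := NeZero.of_pos hc
  have h := fun i₀ => lt_rDavenport_of_relations (stdGen a b c) (stdOrder a b c)
    (by rintro (- | - | i); exacts [hc, hb, ha i]) (stdOrder_dvd a b c) i₀ r hr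
  simp only [Fintype.sum_option] at h
  exact ⟨h none, h (some none)⟩

/-- The bound obtained from a bound on the kernel `C_m × C_n` of the reduction to a `p`-group. -/
theorem rDavenport_prod_le {p : ℕ} (hp : p.Prime) (e : Fin k → ℕ) (f E m n r N : ℕ)
    (hm : 0 < m) (hn : 0 < n)
    (hE : ∑ i, (p ^ e i - 1) + (p ^ f - 1) + 1 ≤ p ^ E)
    (h : ∀ u v : ((i : Fin k) → ZMod (p ^ e i)) × ZMod (m * p ^ f) × ZMod (n * p ^ E),
      m • u = 0 → n • v = 0 → ∃ c, ZeroSumBound (AddSubgroup.closure {u, v}) ⊥ r (N + 1) c) :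
    rDavenport (((i : Fin k) → ZMod (p ^ e i)) × ZMod (m * p ^ f) × ZMod (n * p ^ E)) r ≤
      N * p ^ E + p ^ E + (p ^ f - 1 + ∑ i, (p ^ e i - 1)) := by
  have : Fact p.Prime := ⟨hp⟩
  have hpos : ∀ x, 0 < p ^ x := fun x => Nat.pow_pos hp.pos
  set g := stdGen (fun i => p ^ e i) (m * p ^ f) (n * p ^ E) with hgdef
  have hord := smul_stdGen (fun i => p ^ e i) (m * p ^ f) (n * p ^ E)
  have hclosure : AddSubgroup.closure (Set.range g) = ⊤ :=
    closure_stdGen _ _ _ (fun i => hpos _) (Nat.mul_pos hm (hpos _)) (Nat.mul_pos hn (hpos _))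
  obtain ⟨c, hK⟩ := h (p ^ f • g (some none)) (p ^ E • g none)
    (by rw [← mul_nsmul']; exact hord (some none)) (by rw [← mul_nsmul']; exact hord none)
  set K := AddSubgroup.closure {p ^ f • g (some none), p ^ E • g none} with hKdef
  let e' : Option (Option (Fin k)) → ℕ := fun o => o.elim E fun o => o.elim f e
  have hg : ∀ i, p ^ e' i • g i ∈ K := by
    rintro (- | - | i)
    · exact AddSubgroup.subset_closure (by simp [e'])
    · exact AddSubgroup.subset_closure (by simp [e'])
    · have h0 : p ^ e' (some (some i)) • g (some (some i)) = 0 := hord (some (some i))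
      rw [h0]
      exact K.zero_mem
  have hsum : ∑ i, (p ^ e' i - 1) = p ^ E - 1 + (p ^ f - 1 + ∑ i, (p ^ e i - 1)) := by
    rw [Fintype.sum_option, Fintype.sum_option]
    rfl
  have hEpos := hpos E
  have h1 := ZeroSumBound.davenport_of_closure g e' hg
  have h2 := ZeroSumBound.short_of_closure g e' hg E (by rw [hsum]; omega)
  rw [hsum, hclosure] at h1 h2
  -- `N` short blocks are peeled off, and the final block comes from the weaker Davenport
  -- requirement.
  have h3 := h2.iterate h1 (by omega) (by omega) N
  refine rDavenport_le (by omega) ((h3.comp hK).mono (by omega) le_rfl)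

end PrimePowerTimesRankTwo

/-! ### Assembly over the integers -/

theorem corollary5 (p : ℕ) (hp : p.Prime) (hp2 : p ≠ 2)
    (d : ℕ) (hd : 2 ≤ d) (e : ℕ → ℕ) (he : ∀ i j : ℕ, 1 ≤ i → i ≤ j → j ≤ d → e i ≤ e j)
    (hlarge : 1 + ∑ i ∈ Finset.Icc 1 (d - 1), ((p : ℤ) ^ e i - 1) ≤ (p : ℤ) ^ e d)
    (m n : ℕ) (hm : 1 ≤ m) (hn : 1 ≤ n) (r : ℕ) (hr : 1 ≤ r) :
    (m ∣ n →
      (r : ℤ) * n * p ^ e d + (m - 1) * p ^ e (d - 1)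
          + ∑ i ∈ Finset.Icc 1 (d - 1), (p : ℤ) ^ e i - d + 1
        ≤ (rDavenport (((i : Fin (d - 2)) → ZMod (p ^ e ((i : ℕ) + 1)))
            × ZMod (m * p ^ e (d - 1)) × ZMod (n * p ^ e d)) r : ℤ) ∧
      (rDavenport (((i : Fin (d - 2)) → ZMod (p ^ e ((i : ℕ) + 1)))
            × ZMod (m * p ^ e (d - 1)) × ZMod (n * p ^ e d)) r : ℤ)
        ≤ (r : ℤ) * n * p ^ e d + (m - 1) * p ^ e d
          + ∑ i ∈ Finset.Icc 1 (d - 1), (p : ℤ) ^ e i - d + 1) ∧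
    (n ∣ m →
      max
          ((r : ℤ) * n * p ^ e d + (m - 1) * p ^ e (d - 1)
            + ∑ i ∈ Finset.Icc 1 (d - 1), (p : ℤ) ^ e i - d + 1)
          ((n : ℤ) * p ^ e d + ((r : ℤ) * m - 1) * p ^ e (d - 1)
            + ∑ i ∈ Finset.Icc 1 (d - 1), (p : ℤ) ^ e i - d + 1)
        ≤ (rDavenport (((i : Fin (d - 2)) → ZMod (p ^ e ((i : ℕ) + 1)))
            × ZMod (m * p ^ e (d - 1)) × ZMod (n * p ^ e d)) r : ℤ) ∧
      (rDavenport (((i : Fin (d - 2)) → ZMod (p ^ e ((i : ℕ) + 1)))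
            × ZMod (m * p ^ e (d - 1)) × ZMod (n * p ^ e d)) r : ℤ)
        ≤ (r : ℤ) * m * p ^ e d + (n - 1) * p ^ e d
          + ∑ i ∈ Finset.Icc 1 (d - 1), (p : ℤ) ^ e i - d + 1) := by
  obtain ⟨k, rfl⟩ := Nat.exists_eq_add_of_le' hd
  have hpos : ∀ x, 0 < p ^ x := fun x => Nat.pow_pos hp.pos
  have hsplit : ∀ F : ℕ → ℤ, ∑ i ∈ Finset.Icc 1 (k + 2 - 1), F i
      = ∑ i : Fin k, F ((i : ℕ) + 1) + F (k + 1) := by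
    intro F
    rw [show k + 2 - 1 = k + 1 from rfl, Finset.sum_Icc_succ_top (by omega)]
    congr 1
    clear * -
    induction k with
    | zero => simp
    | succ k ih => rw [Finset.sum_Icc_succ_top (by omega), ih, Fin.sum_univ_castSucc]; simp
  have hcast : ∑ i : Fin k, ((p ^ e ((i : ℕ) + 1) - 1 : ℕ) : ℤ)
      = ∑ i : Fin k, (p : ℤ) ^ e ((i : ℕ) + 1) - k := by
    simp [Nat.cast_sub (hpos _)]
  have hcast1 : ∀ x : ℕ, 0 < x → ((x - 1 : ℕ) : ℤ) = x - 1 := fun x hx => by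
    rw [Nat.cast_sub hx, Nat.cast_one]
  rw [hsplit] at hlarge ⊢
  rw [show k + 2 - 1 = k + 1 from rfl, show k + 2 - 2 = k from rfl]
  have hE : ∑ i : Fin k, (p ^ e ((i : ℕ) + 1) - 1) + (p ^ e (k + 1) - 1) + 1 ≤ p ^ e (k + 2) := by
    zify [hpos (e (k + 1))]
    rw [hcast]
    simp only [Finset.sum_sub_distrib, Finset.sum_const, Finset.card_univ, Fintype.card_fin,
      nsmul_eq_mul, mul_one] at hlarge
    linarith
  have hb : 0 < m * p ^ e (k + 1) := Nat.mul_pos hm (hpos _)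
  have hc : 0 < n * p ^ e (k + 2) := Nat.mul_pos hn (hpos _)
  obtain ⟨hlow, hlow'⟩ := lt_rDavenport_prod (fun i : Fin k => p ^ e ((i : ℕ) + 1))
    (m * p ^ e (k + 1)) (n * p ^ e (k + 2)) (fun i => hpos _) hb hc hr
  have hup := fun N => rDavenport_prod_le hp (fun i : Fin k => e ((i : ℕ) + 1)) (e (k + 1))
    (e (k + 2)) m n r N hm hn hE
  zify [hpos (e (k + 1)), hr] at hlow hlow' hup
  rw [hcast, hcast1 _ hb, hcast1 _ hc] at hlow hlow'
  rw [hcast] at hup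
  push_cast at hlow hlow' hup ⊢
  refine ⟨fun hmn => ⟨by linarith, ?_⟩, fun hnm => ⟨max_le (by linarith) (by linarith), ?_⟩⟩
  · have hrn : 0 < r * n := Nat.mul_pos hr hn
    -- `N + 1` must equal the rank two bound `r * n + m - 1`; the subtraction is exact because `r *
    -- n` and `m` are positive.
    have h := hup (r * n + m - 2) fun u v hu hv => by
      rw [show r * n + m - 2 + 1 = r * n + m - 1 by omega]
      exact ZeroSumBound.rank_two hm hn hmn hr u v hu hv
    rw [Nat.cast_sub (by omega)] at h
    push_cast at h
    linarith
  · have hrm : 0 < r * m := Nat.mul_pos hr hm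
    -- Same argument with the two generators of `K` exchanged.
    have h := hup (r * m + n - 2) fun u v hu hv => by
      rw [show r * m + n - 2 + 1 = r * m + n - 1 by omega, Set.pair_comm]
      exact ZeroSumBound.rank_two hn hm hnm hr v u hv hu
    rw [Nat.cast_sub (by omega)] at h
    push_cast at h
    linarith
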